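/- Let $M$ be a Markov decision process on a finite vertex set $V$, partitioned into control vertices $V_c$ and random vertices $V_r$. Each $v\in V_c$ has a nonempty set $E(v)\subseteq V$ of successors; each $v\in V_r$ has a probability distribution $\delta(v)$ on $V$, whose support is the successor set of $v$. Write $\mathrm{succ}(v)$ for the successor set of $v$. Let $T\subseteq V$ be a set of sinks ($\mathrm{succ}(t)=\{t\}$ for all $t\in T$). In the bidding game on $M$, two players, the reachability and the safety player, have budgets $B$ and $1-B$. At a control vertex both players simultaneously bid at most their current budgets; the higher bidder (the reachability player in case of a tie) pays the bid to the other player and moves the token to a successor. At a random vertex $v$ the token moves according to $\delta(v)$ and the budgets do not change. A policy maps the player's current budget and the finite path so far, ending in a control vertex, to a bid (at most that budget) and a successor. Policies $\sigma,\tau$ of the two players, an initial vertex $v$ and an initial budget $B$ of the reachability player induce a probability measure $\Pr^{\sigma,\tau}_{v,B}$ on infinite paths. Let $\mathrm{Reach}(T)$ be the event that $T$ is eventually visited. Define subsets of $[0,1]^2$ as follows: $\mathsf{rval}^0_v=[0,1]^2$ if $v\in T$ and $\mathsf{rval}^0_v=[0,1]\times\{0\}\cup\{1\}\times[0,1]$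 otherwise; $\mathsf{sval}^0_v=[0,1]\times\{1\}\cup\{0\}\times[0,1]$ if $v\in T$ and $\mathsf{sval}^0_v=[0,1]^2$ otherwise; and $\mathsf{rval}^{i+1}_v=\mathcal T_v\big((\mathsf{rval}^i_w)_w\big)$, $\mathsf{sval}^{i+1}_v=\mathcal T_v\big((\mathsf{sval}^i_w)_w\big)$, where for $v\in V_r$ $$\mathcal T_v\big((\mathrm{val}_w)_w\big)=\Big\{\Big(B,\sum_{w\in\mathrm{succ}(v)}\delta(v)(w)\,p_w\Big)\;\Big|\;B\in[0,1],\ \forall w\in\mathrm{succ}(v):(B,p_w)\in\mathrm{val}_w\Big\}$$ and for $v\in V_c$ $$\mathcal T_v\big((\mathrm{val}_w)_w\big)=\Big\{\Big(\tfrac{B_++B_-}{2},p\Big)\;\Big|\;p\in[0,1],\ \exists w\in\mathrm{succ}(v):(B_-,p)\in\mathrm{val}_w,\ \forall w\in\mathrm{succ}(v):(B_+,p)\in\mathrm{val}_w\Big\}.$$ Put $\mathsf{rval}^*_v=\overline{\bigcup_{i\ge 0}\mathsf{rval}^i_v}$ and $\mathsf{sval}^*_v=\bigcap_{i\ge 0}\mathsf{sval}^i_v$;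 closures and interiors are taken in the Euclidean plane $\mathbb R^2$. Then for every vertex $v$ and every pair $(B,p)$: (A) if $(B,p)$ is in the interior of $\mathsf{rval}^*_v$, then the reachability player has a policy $\sigma$ such that $\Pr^{\sigma,\tau}_{v,B}(\mathrm{Reach}(T))\ge p$ for every policy $\tau$ of the safety player; (B) if $(B,p)$ is in the interior of $\mathsf{sval}^*_v$, then the safety player has a policy $\tau$ such that $\Pr^{\sigma,\tau}_{v,B}(\mathrm{Reach}(T))\le p$ for every policy $\sigma$ of the reachability player. -/

import Mathlib

open MeasureTheory ProbabilityTheory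

/-- A Markov decision process on the vertex set `V`. The vertices in `control` are the control
vertices, all others are random. Only the values of `E` at control vertices and of `δ` at random
vertices are ever used. -/
structure MDP (V : Type*) where
  control : Set V
  E : V → Set V
  E_nonempty : ∀ v ∈ control, (E v).Nonempty
  δ : V → PMF V

namespace MDP

variable {V : Type*}

open Classical in
/-- The set of successors of a vertex. -/
noncomputable def succ (M : MDP V) (v : V) : Set V :=
  if v ∈ M.control then M.E v else {w | M.δ v w ≠ 0}

/-- A vertex is a sink if it is its own only successor. -/
def IsSink (M : MDP V) (v : V) : Prop := M.succ v = {v}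

/-- A finite vertex sequence `v⁰ … vⁿ`. -/
abbrev History (V : Type*) (n : ℕ) : Type _ := Finset.Iic n → V

/-- The last vertex `vⁿ` of `v⁰ … vⁿ`. -/
def History.last {n : ℕ} (h : History V n) : V := h ⟨n, Finset.mem_Iic.2 le_rfl⟩

/-- The prefix `v⁰ … vⁿ` of `v⁰ … vⁿ⁺¹`. -/
def History.init {n : ℕ} (h : History V (n + 1)) : History V n :=
  fun i => h ⟨i, Finset.mem_Iic.2 ((Finset.mem_Iic.1 i.2).trans n.le_succ)⟩

/-- A (deterministic, history dependent) scheduler: it selects a successor of the last vertex of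
every history that ends in a control vertex. Sequences that do not follow the transitions of `M`
are allowed as arguments, but they have probability zero. -/
structure Scheduler (M : MDP V) where
  move : (n : ℕ) → History V n → V
  move_mem : ∀ (n : ℕ) (h : History V n), h.last ∈ M.control → move n h ∈ M.succ h.last

open Classical in
/-- Distribution of the next vertex, given the history. -/
noncomputable def stepPMF (M : MDP V) (θ : M.Scheduler) (n : ℕ) (h : History V n) : PMF V :=
  if h.last ∈ M.control then PMF.pure (θ.move n h) else M.δ h.last

section Probability

variable [Fintype V] [MeasurableSpace V] [DiscreteMeasurableSpace V]

/-- `stepPMF` as a Markov kernel from histories to vertices. -/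
noncomputable def stepKernel (M : MDP V) (θ : M.Scheduler) (n : ℕ) :
    Kernel ((i : Finset.Iic n) → (fun _ : ℕ => V) i) ((fun _ : ℕ => V) (n + 1)) :=
  Kernel.ofFunOfCountable fun h => (M.stepPMF θ n h).toMeasure

instance (M : MDP V) (θ : M.Scheduler) (n : ℕ) : IsMarkovKernel (M.stepKernel θ n) :=
  ⟨fun h => (inferInstance : IsProbabilityMeasure (M.stepPMF θ n h).toMeasure)⟩

/-- The distribution of the infinite path started in `v` under the scheduler `θ`
(Ionescu-Tulcea). -/
noncomputable def pathMeasure (M : MDP V) (θ : M.Scheduler) (v : V) : Measure (ℕ → V) :=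
  Kernel.traj (X := fun _ => V) (M.stepKernel θ) 0 (fun _ => v)

end Probability

/-- A policy of a player: from the player's own available budget and the history it determines a
bid, at most that budget, and a successor of the current control vertex. -/
structure Policy (M : MDP V) where
  bid : ℝ → (n : ℕ) → History V n → ℝ
  move : ℝ → (n : ℕ) → History V n → V
  bid_nonneg : ∀ B ∈ Set.Icc (0 : ℝ) 1, ∀ (n : ℕ) (h : History V n), 0 ≤ bid B n h
  bid_le : ∀ B ∈ Set.Icc (0 : ℝ) 1, ∀ (n : ℕ) (h : History V n), bid B n h ≤ B
  move_mem : ∀ (B : ℝ) (n : ℕ) (h : History V n), h.last ∈ M.control → move B n h ∈ M.succ h.last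

open Classical in
/-- The current budget of the reachability player after a history, when the reachability player
uses `σ`, the safety player uses `τ`, and the reachability player's initial budget is `B` (the
safety player always owns the remaining part of the total budget `1`). The higher bidder pays the
bid to the other player; ties go to the reachability player. -/
noncomputable def budget (M : MDP V) (σ τ : M.Policy) (B : ℝ) : (n : ℕ) → History V n → ℝ
  | 0, _ => B
  | n + 1, h =>
    let B' := M.budget σ τ B n h.init
    if h.init.last ∈ M.control then
      if τ.bid (1 - B') n h.init ≤ σ.bid B' n h.init then B' - σ.bid B' n h.init
      else B' + τ.bid (1 - B') n h.init
    else B'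

open Classical in
/-- The scheduler induced by two policies and the initial budget: the winner of the bidding moves
the token. -/
noncomputable def inducedScheduler (M : MDP V) (σ τ : M.Policy) (B : ℝ) : M.Scheduler where
  move n h :=
    let B' := M.budget σ τ B n h
    if τ.bid (1 - B') n h ≤ σ.bid B' n h then σ.move B' n h else τ.move (1 - B') n h
  move_mem n h hc := by
    dsimp only
    split_ifs
    · exact σ.move_mem _ n h hc
    · exact τ.move_mem _ n h hc

/-- The infinite vertex sequences that eventually visit `T`. -/
def reach (T : Set V) : Set (ℕ → V) := {ω | ∃ i, ω i ∈ T}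

section Winning

variable [Fintype V] [MeasurableSpace V] [DiscreteMeasurableSpace V]

/-- The probability that the play from `v` with initial budget `B` of the reachability player
lies in `φ`. -/
noncomputable def prob (M : MDP V) (σ τ : M.Policy) (v : V) (B : ℝ) (φ : Set (ℕ → V)) : ℝ :=
  (M.pathMeasure (M.inducedScheduler σ τ B) v).real φ

/-- The winning policies of the reachability player. -/
def winReach (M : MDP V) (B p : ℝ) (v : V) (φ : Set (ℕ → V)) : Set M.Policy :=
  {σ | ∀ τ : M.Policy, p ≤ M.prob σ τ v B φ}

/-- The winning policies of the safety player. -/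
def winSafe (M : MDP V) (B p : ℝ) (v : V) (φ : Set (ℕ → V)) : Set M.Policy :=
  {τ | ∀ σ : M.Policy, M.prob σ τ v B φ ≤ p}

end Winning

section Values

variable [Fintype V]

open Classical in
/-- The Bellman-type operator at `v`, on families of sets of pairs (budget, probability). In the
sum only the successors `w` of `v` contribute, since `δ v w = 0` for all others. -/
noncomputable def bellman (M : MDP V) (val : V → Set (ℝ × ℝ)) (v : V) : Set (ℝ × ℝ) :=
  if v ∈ M.control then
    {x | ∃ p ∈ Set.Icc (0 : ℝ) 1, ∃ Bminus Bplus : ℝ,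
      (∃ w ∈ M.succ v, (Bminus, p) ∈ val w) ∧ (∀ w ∈ M.succ v, (Bplus, p) ∈ val w) ∧
      x = ((Bplus + Bminus) / 2, p)}
  else
    {x | ∃ B ∈ Set.Icc (0 : ℝ) 1, ∃ q : V → ℝ,
      (∀ w ∈ M.succ v, (B, q w) ∈ val w) ∧ x = (B, ∑ w, (M.δ v w).toReal * q w)}

open Classical in
/-- The value sets of the reachability player for horizon `i`. -/
noncomputable def rVal (M : MDP V) (T : Set V) : ℕ → V → Set (ℝ × ℝ)
  | 0, v =>
    if v ∈ T then Set.Icc (0 : ℝ) 1 ×ˢ Set.Icc (0 : ℝ) 1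
    else Set.Icc (0 : ℝ) 1 ×ˢ {0} ∪ {1} ×ˢ Set.Icc (0 : ℝ) 1
  | i + 1, v => M.bellman (M.rVal T i) v

open Classical in
/-- The value sets of the safety player for horizon `i`. -/
noncomputable def sVal (M : MDP V) (T : Set V) : ℕ → V → Set (ℝ × ℝ)
  | 0, v =>
    if v ∈ T then Set.Icc (0 : ℝ) 1 ×ˢ {1} ∪ {0} ×ˢ Set.Icc (0 : ℝ) 1
    else Set.Icc (0 : ℝ) 1 ×ˢ Set.Icc (0 : ℝ) 1
  | i + 1, v => M.bellman (M.sVal T i) v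

/-- The limit value set of the reachability player. -/
noncomputable def rValStar (M : MDP V) (T : Set V) (v : V) : Set (ℝ × ℝ) :=
  closure (⋃ i, M.rVal T i v)

/-- The limit value set of the safety player. -/
noncomputable def sValStar (M : MDP V) (T : Set V) (v : V) : Set (ℝ × ℝ) :=
  ⋂ i, M.sVal T i v

end Values

end MDP

/-! Each value set is read as a set of promises and turned into a function of the reachability
player's budget `b`: `lowerVal` is the best probability promised at some budget strictly below `b`,
`upperVal` the best bound promised at some budget strictly above `b`. Interior points supply this
strict slack in both coordinates. The strictness also removes the artificial segments {1}×[0,1] and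
{0}×[0,1] of the initial sets. The core is one bidding round. If B₊ and B₋ witness membership in the
Bellman set of a control vertex, bidding half their difference leaves the player on the good side of
B₋ after winning and of B₊ after losing (`exists_reach_bid`, `exists_safe_bid`). At random vertices
the promises average. Suprema and infima need not be attained, so each round costs a small error.
For reachability, a point near the closure lies in some finite-horizon set. Playing N rounds makes
the remaining-horizon value, corrected by the errors still to come, a submartingale that ends below
the indicator of having visited T (`le_pathMeasure_reach`). For safety the play never ends, so the
limit set itself must satisfy `sValStar` ⊆ `bellman sValStar`. This follows from compactness along
the decreasing closed sets `sVal`. With errors halving each round, the value becomes a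
supermartingale dominating the indicator (`pathMeasure_reach_le`). -/

namespace MDP

/-! ### Histories, one-step expectations and martingale bounds -/

variable {V : Type*}

/-- The history `h` followed by the vertex `w`. -/
def History.snoc {n : ℕ} (h : History V n) (w : V) : History V (n + 1) :=
  fun i => if hi : i.1 ≤ n then h ⟨i, Finset.mem_Iic.2 hi⟩ else w

@[simp] lemma History.init_snoc {n : ℕ} (h : History V n) (w : V) : (h.snoc w).init = h := by
  funext i
  simp [History.init, History.snoc, Finset.mem_Iic.1 i.2]

@[simp] lemma History.last_snoc {n : ℕ} (h : History V n) (w : V) : (h.snoc w).last = w := by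
  simp [History.last, History.snoc]

/-- The history visits the set `T`. -/
def History.Visits {n : ℕ} (h : History V n) (T : Set V) : Prop := ∃ i, h i ∈ T

lemma History.visits_snoc {n : ℕ} (h : History V n) (w : V) (T : Set V) :
    (h.snoc w).Visits T ↔ h.Visits T ∨ w ∈ T := by
  constructor
  · rintro ⟨i, hi⟩
    by_cases hin : i.1 ≤ n
    · exact Or.inl ⟨⟨i, Finset.mem_Iic.2 hin⟩, by simpa [History.snoc, hin] using hi⟩
    · exact Or.inr (by simpa [History.snoc, hin] using hi)
  · rintro (⟨i, hi⟩ | hw)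
    · refine ⟨⟨i, Finset.mem_Iic.2 ((Finset.mem_Iic.1 i.2).trans n.le_succ)⟩, ?_⟩
      simpa [History.snoc, Finset.mem_Iic.1 i.2] using hi
    · exact ⟨⟨n + 1, Finset.mem_Iic.2 le_rfl⟩, by simpa [History.snoc] using hw⟩

variable [Fintype V]

/-- The expectation over the next vertex. -/
noncomputable def stepExp (M : MDP V) (θ : M.Scheduler) {n : ℕ} (h : History V n) (f : V → ℝ) :
    ℝ := ∑ w, (M.stepPMF θ n h w).toReal * f w

lemma sum_toReal_PMF {α : Type*} [Fintype α] (q : PMF α) : ∑ w, (q w).toReal = 1 := by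
  rw [← ENNReal.toReal_sum fun w _ => q.apply_ne_top w, ← tsum_fintype (L := .unconditional _),
    q.tsum_coe, ENNReal.toReal_one]

lemma stepExp_mono (M : MDP V) (θ : M.Scheduler) {n : ℕ} (h : History V n) {f g : V → ℝ}
    (hfg : ∀ w, f w ≤ g w) : M.stepExp θ h f ≤ M.stepExp θ h g :=
  Finset.sum_le_sum fun w _ => mul_le_mul_of_nonneg_left (hfg w) ENNReal.toReal_nonneg

lemma stepExp_add_const (M : MDP V) (θ : M.Scheduler) {n : ℕ} (h : History V n) (f : V → ℝ)
    (c : ℝ) : M.stepExp θ h (fun w => f w + c) = M.stepExp θ h f + c := by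
  simp only [stepExp, mul_add, Finset.sum_add_distrib, ← Finset.sum_mul, sum_toReal_PMF, one_mul]

lemma stepExp_const (M : MDP V) (θ : M.Scheduler) {n : ℕ} (h : History V n) (c : ℝ) :
    M.stepExp θ h (fun _ => c) = c := by
  simp only [stepExp, ← Finset.sum_mul, sum_toReal_PMF, one_mul]

lemma stepExp_of_control (M : MDP V) (θ : M.Scheduler) {n : ℕ} (h : History V n) (f : V → ℝ)
    (hc : h.last ∈ M.control) : M.stepExp θ h f = f (θ.move n h) := by
  classical
  rw [stepExp, Finset.sum_eq_single (θ.move n h)]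
  · simp [stepPMF, hc]
  · intro w _ hw
    simp [stepPMF, hc, hw]
  · simp

lemma stepExp_of_random (M : MDP V) (θ : M.Scheduler) {n : ℕ} (h : History V n) (f : V → ℝ)
    (hc : h.last ∉ M.control) : M.stepExp θ h f = ∑ w, (M.δ h.last w).toReal * f w := by
  simp [stepExp, stepPMF, hc]

variable [MeasurableSpace V] [DiscreteMeasurableSpace V]

/-- The distribution of the history of length `n`. -/
noncomputable def historyMeasure (M : MDP V) (θ : M.Scheduler) (v : V) (n : ℕ) :
    Measure (History V n) :=
  Kernel.partialTraj (X := fun _ => V) (M.stepKernel θ) 0 n (fun _ => v)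

instance (M : MDP V) (θ : M.Scheduler) (v : V) (n : ℕ) :
    IsProbabilityMeasure (M.historyMeasure θ v n) := by
  unfold historyMeasure
  infer_instance

lemma integral_historyMeasure_zero (M : MDP V) (θ : M.Scheduler) (v : V)
    (W : History V 0 → ℝ) : ∫ h, W h ∂(M.historyMeasure θ v 0) = W (fun _ => v) := by
  rw [historyMeasure, Kernel.partialTraj_self, Kernel.id_apply, integral_dirac]

/-- The kernel keeps the past as a Dirac mass and draws one new vertex from `stepPMF`; gluing the
two is `History.snoc`, and the integral over the new vertex is a finite sum. -/
lemma integral_partialTraj_succ_self (M : MDP V) (θ : M.Scheduler) {n : ℕ} (h : History V n)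
    (W : History V (n + 1) → ℝ) :
    ∫ x, W x ∂(Kernel.partialTraj (X := fun _ => V) (M.stepKernel θ) n (n + 1) h) =
      M.stepExp θ h fun w => W (h.snoc w) := by
  have hm := measurable_IicProdIoc (X := fun _ : ℕ => V) (m := n) (n := n + 1)
  rw [Kernel.partialTraj_succ_self, Kernel.map_apply _ hm,
    integral_map hm.aemeasurable
      (Measurable.of_discrete (f := W)).aestronglyMeasurable,
    Kernel.prod_apply, Kernel.id_apply,
    Kernel.map_apply _ (MeasurableEquiv.piSingleton (X := fun _ => V) n).measurable,
    Measure.dirac_prod, integral_map (by fun_prop) (by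
      exact (Measurable.of_discrete (f := W)).comp hm
        |>.aestronglyMeasurable),
    integral_map (by fun_prop) (by
      exact (Measurable.of_discrete (f := W)).comp (hm.comp (by fun_prop))
        |>.aestronglyMeasurable)]
  have key : ∀ w : V, IicProdIoc (X := fun _ => V) n (n + 1)
      (h, MeasurableEquiv.piSingleton (X := fun _ => V) n w) = h.snoc w := by
    intro w
    funext i
    simp only [IicProdIoc, History.snoc, MeasurableEquiv.piSingleton]
    split_ifs <;> simp
  simp only [key]
  simp only [stepKernel, Kernel.ofFunOfCountable]
  exact PMF.integral_eq_sum _ _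

lemma integral_historyMeasure_succ (M : MDP V) (θ : M.Scheduler) (v : V) (n : ℕ)
    (W : History V (n + 1) → ℝ) :
    ∫ h, W h ∂(M.historyMeasure θ v (n + 1)) =
      ∫ h, M.stepExp θ h (fun w => W (h.snoc w)) ∂(M.historyMeasure θ v n) := by
  rw [historyMeasure, Kernel.partialTraj_succ_eq_comp (Nat.zero_le n), Kernel.integral_comp]
  · simp only [integral_partialTraj_succ_self]
    rfl
  · exact Integrable.of_finite

open Classical in
/-- The indicator of the histories that visit `T`. -/
noncomputable def visitInd (T : Set V) {n : ℕ} (h : History V n) : ℝ :=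
  if h.Visits T then 1 else 0

/-- `historyMeasure` is the image of `pathMeasure` under restriction to the first coordinates. -/
lemma integral_visitInd (M : MDP V) (θ : M.Scheduler) (v : V) (n : ℕ) (T : Set V) :
    ∫ h, visitInd T h ∂(M.historyMeasure θ v n) =
      (M.pathMeasure θ v).real {ω | ∃ i ≤ n, ω i ∈ T} := by
  have h1 : ∀ h : History V n,
      visitInd T h = Set.indicator {h : History V n | h.Visits T} 1 h := by
    intro h
    by_cases hv : h.Visits T <;> simp [visitInd, hv]
  simp only [h1]
  rw [integral_indicator_one MeasurableSet.of_discrete, historyMeasure,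
    ← Kernel.traj_map_frestrictLe_apply, pathMeasure,
    map_measureReal_apply (Preorder.measurable_frestrictLe n) MeasurableSet.of_discrete]
  congr 1
  ext ω
  simp [History.Visits, Preorder.frestrictLe]

instance (M : MDP V) (θ : M.Scheduler) (v : V) : IsProbabilityMeasure (M.pathMeasure θ v) := by
  unfold pathMeasure
  infer_instance

/-- A family which is a submartingale up to time `N` and which at time `N` is bounded by the
indicator of having visited `T` bounds the reachability probability from below. -/
lemma le_pathMeasure_reach (M : MDP V) (θ : M.Scheduler) (v : V) (T : Set V) (N : ℕ)
    (W : ∀ n, History V n → ℝ)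
    (hstep : ∀ n < N, ∀ h, W n h ≤ M.stepExp θ h fun w => W (n + 1) (h.snoc w))
    (hN : ∀ h, W N h ≤ visitInd T h) :
    W 0 (fun _ => v) ≤ (M.pathMeasure θ v).real (reach T) := by
  have h1 : ∀ n ≤ N, W 0 (fun _ => v) ≤ ∫ h, W n h ∂(M.historyMeasure θ v n) := by
    intro n
    induction n with
    | zero => intro _; rw [integral_historyMeasure_zero]
    | succ n ih =>
      intro hn
      rw [integral_historyMeasure_succ]
      exact (ih (by omega)).trans
        (integral_mono Integrable.of_finite Integrable.of_finite (hstep n hn))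
  refine (h1 N le_rfl).trans
    ((integral_mono Integrable.of_finite Integrable.of_finite hN).trans ?_)
  rw [integral_visitInd]
  exact measureReal_mono fun ω ⟨i, _, hi⟩ => ⟨i, hi⟩

/-- A supermartingale that dominates the indicator of having visited `T` bounds the reachability
probability from above. -/
lemma pathMeasure_reach_le (M : MDP V) (θ : M.Scheduler) (v : V) (T : Set V)
    (W : ∀ n, History V n → ℝ)
    (hstep : ∀ n h, (M.stepExp θ h fun w => W (n + 1) (h.snoc w)) ≤ W n h)
    (hind : ∀ n h, visitInd T h ≤ W n h) :
    (M.pathMeasure θ v).real (reach T) ≤ W 0 (fun _ => v) := by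
  have h1 : ∀ n, ∫ h, W n h ∂(M.historyMeasure θ v n) ≤ W 0 (fun _ => v) := by
    intro n
    induction n with
    | zero => rw [integral_historyMeasure_zero]
    | succ n ih =>
      rw [integral_historyMeasure_succ]
      exact (integral_mono Integrable.of_finite Integrable.of_finite (hstep n)).trans ih
  have h2 : ∀ n, (M.pathMeasure θ v).real {ω | ∃ i ≤ n, ω i ∈ T} ≤ W 0 (fun _ => v) := by
    intro n
    rw [← integral_visitInd]
    exact (integral_mono Integrable.of_finite Integrable.of_finite (hind n)).trans (h1 n)
  -- The bound holds for visits up to every finite time; continuity of the measure from below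
  -- carries it to `reach T`.
  have hmono : Monotone fun n : ℕ => {ω : ℕ → V | ∃ i ≤ n, ω i ∈ T} :=
    fun m n hmn ω ⟨i, hi, h⟩ => ⟨i, hi.trans hmn, h⟩
  have hU : reach T = ⋃ n : ℕ, {ω : ℕ → V | ∃ i ≤ n, ω i ∈ T} := by
    ext ω
    simp only [reach, Set.mem_ofPred_eq, Set.mem_iUnion]
    exact ⟨fun ⟨i, hi⟩ => ⟨i, i, le_rfl, hi⟩, fun ⟨_, i, _, hi⟩ => ⟨i, hi⟩⟩
  rw [hU]
  exact le_of_tendsto' ((ENNReal.tendsto_toReal (measure_ne_top _ _)).comp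
    (tendsto_measure_iUnion_atTop hmono)) h2

end MDP

/-! ### Value functions of sets of promises -/

namespace MDP

variable {V : Type*}

/-- The unit square of pairs (budget, probability). -/
def unitSquare : Set (ℝ × ℝ) := Set.Icc (0 : ℝ) 1 ×ˢ Set.Icc (0 : ℝ) 1

/-- The supremum of the probabilities promised by `R` to a reachability player whose budget
is `b`. -/
noncomputable def lowerVal (R : Set (ℝ × ℝ)) (b : ℝ) : ℝ :=
  sSup (insert 0 {p | ∃ B < b, (B, p) ∈ R})

/-- The infimum of the probabilities promised by `S` to a safety player against a reachability
player whose budget is `b`. -/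
noncomputable def upperVal (S : Set (ℝ × ℝ)) (b : ℝ) : ℝ :=
  sInf (insert 1 {p | ∃ B > b, (B, p) ∈ S})

section Bounds

variable {R : Set (ℝ × ℝ)} {b : ℝ}

lemma bddAbove_lowerVal (hR : R ⊆ unitSquare) :
    BddAbove (insert 0 {p | ∃ B < b, (B, p) ∈ R}) := by
  refine ⟨1, ?_⟩
  rintro p (rfl | ⟨B, _, h⟩)
  · exact zero_le_one
  · exact (hR h).2.2

lemma bddBelow_upperVal (hR : R ⊆ unitSquare) :
    BddBelow (insert 1 {p | ∃ B > b, (B, p) ∈ R}) := by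
  refine ⟨0, ?_⟩
  rintro p (rfl | ⟨B, _, h⟩)
  · exact zero_le_one
  · exact (hR h).2.1

lemma lowerVal_nonneg (hR : R ⊆ unitSquare) : 0 ≤ lowerVal R b :=
  le_csSup (bddAbove_lowerVal hR) (Set.mem_insert _ _)

lemma upperVal_le_one (hR : R ⊆ unitSquare) : upperVal R b ≤ 1 :=
  csInf_le (bddBelow_upperVal hR) (Set.mem_insert _ _)

lemma lowerVal_le_one (hR : R ⊆ unitSquare) : lowerVal R b ≤ 1 := by
  refine csSup_le (Set.insert_nonempty _ _) ?_
  rintro p (rfl | ⟨B, _, h⟩)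
  · exact zero_le_one
  · exact (hR h).2.2

lemma upperVal_nonneg (hR : R ⊆ unitSquare) : 0 ≤ upperVal R b := by
  refine le_csInf (Set.insert_nonempty _ _) ?_
  rintro p (rfl | ⟨B, _, h⟩)
  · exact zero_le_one
  · exact (hR h).2.1

lemma le_lowerVal (hR : R ⊆ unitSquare) {B p : ℝ} (hB : B < b) (h : (B, p) ∈ R) :
    p ≤ lowerVal R b :=
  le_csSup (bddAbove_lowerVal hR) (Set.mem_insert_of_mem _ ⟨B, hB, h⟩)

lemma upperVal_le (hR : R ⊆ unitSquare) {B p : ℝ} (hB : b < B) (h : (B, p) ∈ R) :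
    upperVal R b ≤ p :=
  csInf_le (bddBelow_upperVal hR) (Set.mem_insert_of_mem _ ⟨B, hB, h⟩)

end Bounds

/-! ### Construction of policies and evolution of the budget -/

/-- A policy can be assembled from choices at the single histories and budgets. -/
lemma exists_policy (M : MDP V) (P : ∀ n, History V n → ℝ → ℝ → V → Prop)
    (hP : ∀ n (h : History V n) b, h.last ∈ M.control → b ∈ Set.Icc (0 : ℝ) 1 →
      ∃ x w, 0 ≤ x ∧ x ≤ b ∧ w ∈ M.succ h.last ∧ P n h b x w) :
    ∃ π : M.Policy, ∀ n (h : History V n) b, h.last ∈ M.control → b ∈ Set.Icc (0 : ℝ) 1 →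
      P n h b (π.bid b n h) (π.move b n h) := by
  -- A policy must be defined everywhere, so each requirement is made conditional; bid 0 serves
  -- wherever `P` is not demanded.
  have key : ∀ n (h : History V n) b, ∃ x w, (b ∈ Set.Icc (0 : ℝ) 1 → 0 ≤ x ∧ x ≤ b) ∧
      (h.last ∈ M.control → w ∈ M.succ h.last) ∧
      (h.last ∈ M.control → b ∈ Set.Icc (0 : ℝ) 1 → P n h b x w) := by
    intro n h b
    by_cases hc : h.last ∈ M.control
    · by_cases hb : b ∈ Set.Icc (0 : ℝ) 1
      · obtain ⟨x, w, h0, h1, h2, h3⟩ := hP n h b hc hb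
        exact ⟨x, w, fun _ => ⟨h0, h1⟩, fun _ => h2, fun _ _ => h3⟩
      · obtain ⟨w, hw⟩ := M.E_nonempty _ hc
        exact ⟨0, w, fun h => absurd h hb, fun _ => by simpa [succ, hc] using hw,
          fun _ h => absurd h hb⟩
    · exact ⟨0, h.last, fun hb => ⟨le_rfl, hb.1⟩, fun h => absurd h hc, fun h => absurd h hc⟩
  choose x w h0 h1 h2 using key
  exact ⟨⟨fun b n h => x n h b, fun b n h => w n h b, fun b hb n h => (h0 n h b hb).1,
    fun b hb n h => (h0 n h b hb).2, fun b n h => h1 n h b⟩, h2⟩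

lemma budget_mem (M : MDP V) (σ τ : M.Policy) {B : ℝ} (hB : B ∈ Set.Icc (0 : ℝ) 1) :
    ∀ n (h : History V n), M.budget σ τ B n h ∈ Set.Icc (0 : ℝ) 1
  | 0, _ => hB
  | n + 1, h => by
    have ih := budget_mem M σ τ hB n h.init
    have ih' : 1 - M.budget σ τ B n h.init ∈ Set.Icc (0 : ℝ) 1 :=
      ⟨by linarith [ih.2], by linarith [ih.1]⟩
    have h1 := σ.bid_nonneg _ ih n h.init
    have h2 := σ.bid_le _ ih n h.init
    have h3 := τ.bid_nonneg _ ih' n h.init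
    have h4 := τ.bid_le _ ih' n h.init
    simp only [budget]
    split_ifs
    · exact ⟨by linarith, by linarith [ih.2]⟩
    · exact ⟨by linarith [ih.1], by linarith⟩
    · exact ih

lemma budget_snoc_of_random (M : MDP V) (σ τ : M.Policy) (B : ℝ) {n : ℕ} (h : History V n)
    (w : V) (hc : h.last ∉ M.control) :
    M.budget σ τ B (n + 1) (h.snoc w) = M.budget σ τ B n h := by
  simp [budget, hc]

lemma budget_snoc_of_le (M : MDP V) (σ τ : M.Policy) (B : ℝ) {n : ℕ} (h : History V n)
    (w : V) (hc : h.last ∈ M.control)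
    (hb : τ.bid (1 - M.budget σ τ B n h) n h ≤ σ.bid (M.budget σ τ B n h) n h) :
    M.budget σ τ B (n + 1) (h.snoc w) =
      M.budget σ τ B n h - σ.bid (M.budget σ τ B n h) n h := by
  simp [budget, hc, hb]

lemma budget_snoc_of_lt (M : MDP V) (σ τ : M.Policy) (B : ℝ) {n : ℕ} (h : History V n)
    (w : V) (hc : h.last ∈ M.control)
    (hb : σ.bid (M.budget σ τ B n h) n h < τ.bid (1 - M.budget σ τ B n h) n h) :
    M.budget σ τ B (n + 1) (h.snoc w) =
      M.budget σ τ B n h + τ.bid (1 - M.budget σ τ B n h) n h := by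
  simp [budget, hc, hb.not_ge]

lemma toReal_eq_zero_of_notMem_succ (M : MDP V) {v w : V} (hc : v ∉ M.control)
    (hw : w ∉ M.succ v) : (M.δ v w).toReal = 0 := by
  have : M.δ v w = 0 := by simpa [succ, hc] using hw
  simp [this]

/-! ### The Bellman operator and a single round of the game -/

variable [Fintype V]

lemma mem_bellman_of_control (M : MDP V) (val : V → Set (ℝ × ℝ)) {v : V} (hc : v ∈ M.control)
    (x : ℝ × ℝ) : x ∈ M.bellman val v ↔ ∃ p ∈ Set.Icc (0 : ℝ) 1, ∃ Bminus Bplus : ℝ,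
      (∃ w ∈ M.succ v, (Bminus, p) ∈ val w) ∧ (∀ w ∈ M.succ v, (Bplus, p) ∈ val w) ∧
      x = ((Bplus + Bminus) / 2, p) := by
  simp only [bellman, hc, if_true]
  rfl

lemma mem_bellman_of_random (M : MDP V) (val : V → Set (ℝ × ℝ)) {v : V} (hc : v ∉ M.control)
    (x : ℝ × ℝ) : x ∈ M.bellman val v ↔ ∃ B ∈ Set.Icc (0 : ℝ) 1, ∃ q : V → ℝ,
      (∀ w ∈ M.succ v, (B, q w) ∈ val w) ∧ x = (B, ∑ w, (M.δ v w).toReal * q w) := by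
  simp only [bellman, hc, if_false]
  rfl

/-- Sums over `δ v` only depend on the values at successors. -/
lemma sum_le_sum_of_succ (M : MDP V) {v : V} (hc : v ∉ M.control) {f g : V → ℝ}
    (hfg : ∀ w ∈ M.succ v, f w ≤ g w) :
    ∑ w, (M.δ v w).toReal * f w ≤ ∑ w, (M.δ v w).toReal * g w := by
  refine Finset.sum_le_sum fun w _ => ?_
  by_cases hw : w ∈ M.succ v
  · exact mul_le_mul_of_nonneg_left (hfg w hw) ENNReal.toReal_nonneg
  · simp [M.toReal_eq_zero_of_notMem_succ hc hw]

lemma sum_const (M : MDP V) (v : V) (c : ℝ) : ∑ w, (M.δ v w).toReal * c = c := by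
  rw [← Finset.sum_mul, sum_toReal_PMF, one_mul]

lemma bellman_subset_unitSquare (M : MDP V) {val : V → Set (ℝ × ℝ)}
    (hval : ∀ w, val w ⊆ unitSquare) (v : V) : M.bellman val v ⊆ unitSquare := by
  intro x hx
  by_cases hc : v ∈ M.control
  · obtain ⟨p, hp, Bm, Bp, ⟨w, hw, h1⟩, h2, rfl⟩ := (M.mem_bellman_of_control val hc x).1 hx
    have h3 := (hval w h1).1
    have h4 := (hval w (h2 w hw)).1
    exact ⟨⟨by linarith [h3.1, h4.1], by linarith [h3.2, h4.2]⟩, hp⟩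
  · obtain ⟨B, hB, q, hq, rfl⟩ := (M.mem_bellman_of_random val hc x).1 hx
    refine ⟨hB, ?_, ?_⟩
    · exact (M.sum_const v 0).symm.trans_le
        (M.sum_le_sum_of_succ hc fun w hw => (hval w (hq w hw)).2.1)
    · exact (M.sum_le_sum_of_succ hc fun w hw => (hval w (hq w hw)).2.2).trans_eq (M.sum_const v 1)

lemma bellman_mono (M : MDP V) {val val' : V → Set (ℝ × ℝ)} (h : ∀ w, val w ⊆ val' w) (v : V) :
    M.bellman val v ⊆ M.bellman val' v := by
  intro x hx
  by_cases hc : v ∈ M.control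
  · obtain ⟨p, hp, Bm, Bp, ⟨w, hw, h1⟩, h2, h3⟩ := (M.mem_bellman_of_control val hc x).1 hx
    exact (M.mem_bellman_of_control val' hc x).2
      ⟨p, hp, Bm, Bp, ⟨w, hw, h w h1⟩, fun w hw => h w (h2 w hw), h3⟩
  · obtain ⟨B, hB, q, hq, h3⟩ := (M.mem_bellman_of_random val hc x).1 hx
    exact (M.mem_bellman_of_random val' hc x).2 ⟨B, hB, q, fun w hw => h w (hq w hw), h3⟩

lemma rVal_subset_unitSquare (M : MDP V) (T : Set V) : ∀ i v, M.rVal T i v ⊆ unitSquare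
  | 0, v => by
    simp only [rVal, unitSquare]
    split_ifs
    · exact subset_rfl
    · rintro ⟨B, p⟩ (⟨hB, rfl⟩ | ⟨rfl, hp⟩)
      · exact ⟨hB, by simp⟩
      · exact ⟨by simp, hp⟩
  | i + 1, v => M.bellman_subset_unitSquare (M.rVal_subset_unitSquare T i) v

lemma sVal_subset_unitSquare (M : MDP V) (T : Set V) : ∀ i v, M.sVal T i v ⊆ unitSquare
  | 0, v => by
    simp only [sVal, unitSquare]
    split_ifs
    · rintro ⟨B, p⟩ (⟨hB, rfl⟩ | ⟨rfl, hp⟩)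
      · exact ⟨hB, by simp⟩
      · exact ⟨by simp, hp⟩
    · exact subset_rfl
  | i + 1, v => M.bellman_subset_unitSquare (M.sVal_subset_unitSquare T i) v

/-- The probability promised by the Bellman operator at a control vertex can be secured by the
reachability player in one bidding round. -/
lemma exists_reach_bid (M : MDP V) {R : V → Set (ℝ × ℝ)} (hR : ∀ w, R w ⊆ unitSquare) {v : V}
    (hc : v ∈ M.control) {b : ℝ} (hb : b ∈ Set.Icc (0 : ℝ) 1) {ε : ℝ} (hε : 0 < ε) :
    ∃ x w, 0 ≤ x ∧ x ≤ b ∧ w ∈ M.succ v ∧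
      (lowerVal (M.bellman R v) b - ε ≤ lowerVal (R w) (b - x) ∧
        ∀ y, x < y → ∀ u ∈ M.succ v, lowerVal (M.bellman R v) b - ε ≤ lowerVal (R u) (b + y)) := by
  obtain ⟨p, hp, hlt⟩ := exists_lt_of_lt_csSup (Set.insert_nonempty _ _)
    (show lowerVal (M.bellman R v) b - ε < sSup _ from sub_lt_self _ hε)
  rcases hp with rfl | ⟨B, hB, hmem⟩
  · obtain ⟨w, hw⟩ := M.E_nonempty _ hc
    exact ⟨0, w, le_rfl, hb.1, by simpa [succ, hc] using hw,
      hlt.le.trans (lowerVal_nonneg (hR _)),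
      fun y _ u _ => hlt.le.trans (lowerVal_nonneg (hR _))⟩
  · obtain ⟨p', hp', Bm, Bp, ⟨w, hw, h1⟩, h2, h3⟩ := (M.mem_bellman_of_control R hc _).1 hmem
    obtain ⟨rfl, rfl⟩ := Prod.mk.inj h3
    have hBm : 0 ≤ Bm := (hR w h1).1.1
    have hBp : 0 ≤ Bp := (hR w (h2 w hw)).1.1
    -- Since b > (B₊+B₋)/2, the bid (B₊-B₋)/2 leaves more than B₋ after a win, and any higher
    -- opposing bid lifts the budget above B₊. If B₊ ≤ B₋ that bid would be negative, but then b
    -- already exceeds B₊, where every successor promises p, and bid 0 suffices.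
    rcases le_total Bm Bp with hle | hle
    · refine ⟨(Bp - Bm) / 2, w, by linarith, by linarith, hw,
        hlt.le.trans (le_lowerVal (hR w) (by linarith) h1), fun y hy u hu =>
        hlt.le.trans (le_lowerVal (hR u) (by linarith) (h2 u hu))⟩
    · refine ⟨0, w, le_rfl, hb.1, hw,
        hlt.le.trans (le_lowerVal (hR w) (by linarith) (h2 w hw)), fun y hy u hu =>
        hlt.le.trans (le_lowerVal (hR u) (by linarith) (h2 u hu))⟩

/-- The budget does not change at a random vertex, so one B < b serves all successors and their
promises average. -/
lemma lowerVal_bellman_le_of_random (M : MDP V) {R : V → Set (ℝ × ℝ)}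
    (hR : ∀ w, R w ⊆ unitSquare) {v : V} (hc : v ∉ M.control) (b : ℝ) :
    lowerVal (M.bellman R v) b ≤ ∑ w, (M.δ v w).toReal * lowerVal (R w) b := by
  refine csSup_le (Set.insert_nonempty _ _) ?_
  rintro p (rfl | ⟨B, hB, hmem⟩)
  · exact Finset.sum_nonneg fun w _ => mul_nonneg ENNReal.toReal_nonneg (lowerVal_nonneg (hR w))
  · obtain ⟨B', _, q, hq, h3⟩ := (M.mem_bellman_of_random R hc _).1 hmem
    obtain ⟨rfl, rfl⟩ := Prod.mk.inj h3
    exact M.sum_le_sum_of_succ hc fun w hw => le_lowerVal (hR w) hB (hq w hw)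

/-- The bound promised by the Bellman operator at a control vertex can be secured by the
safety player in one bidding round. Here `c` is the budget of the safety player. -/
lemma exists_safe_bid (M : MDP V) {S : V → Set (ℝ × ℝ)} (hS : ∀ w, S w ⊆ unitSquare) {v : V}
    (hc : v ∈ M.control) {c : ℝ} (hb : c ∈ Set.Icc (0 : ℝ) 1) {ε : ℝ} (hε : 0 < ε) :
    ∃ x w, 0 ≤ x ∧ x ≤ c ∧ w ∈ M.succ v ∧
      (upperVal (S w) (1 - c + x) ≤ upperVal (M.bellman S v) (1 - c) + ε ∧
        ∀ y, x ≤ y → ∀ u ∈ M.succ v,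
          upperVal (S u) (1 - c - y) ≤ upperVal (M.bellman S v) (1 - c) + ε) := by
  obtain ⟨p, hp, hlt⟩ := exists_lt_of_csInf_lt (Set.insert_nonempty _ _)
    (show sInf _ < upperVal (M.bellman S v) (1 - c) + ε from lt_add_of_pos_right _ hε)
  rcases hp with rfl | ⟨B, hB, hmem⟩
  · obtain ⟨w, hw⟩ := M.E_nonempty _ hc
    exact ⟨0, w, le_rfl, hb.1, by simpa [succ, hc] using hw,
      (upperVal_le_one (hS _)).trans hlt.le,
      fun y _ u _ => (upperVal_le_one (hS _)).trans hlt.le⟩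
  · obtain ⟨p', hp', Bm, Bp, ⟨w, hw, h1⟩, h2, h3⟩ := (M.mem_bellman_of_control S hc _).1 hmem
    obtain ⟨rfl, rfl⟩ := Prod.mk.inj h3
    have hBm : Bm ≤ 1 := (hS w h1).1.2
    have hBp : Bp ≤ 1 := (hS w (h2 w hw)).1.2
    -- Mirror image: paying (B₋-B₊)/2 keeps the reachability budget below B₋, and receiving at least
    -- that much pushes it below B₊. The bid is affordable because B₋ ≤ 1.
    rcases le_total Bp Bm with hle | hle
    · refine ⟨(Bm - Bp) / 2, w, by linarith, by linarith, hw,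
        (upperVal_le (hS w) (by linarith) h1).trans hlt.le, fun y hy u hu =>
        (upperVal_le (hS u) (by linarith) (h2 u hu)).trans hlt.le⟩
    · refine ⟨0, w, le_rfl, hb.1, hw,
        (upperVal_le (hS w) (by linarith) (h2 w hw)).trans hlt.le, fun y hy u hu =>
        (upperVal_le (hS u) (by linarith) (h2 u hu)).trans hlt.le⟩

lemma le_upperVal_bellman_of_random (M : MDP V) {S : V → Set (ℝ × ℝ)}
    (hS : ∀ w, S w ⊆ unitSquare) {v : V} (hc : v ∉ M.control) (b : ℝ) :
    ∑ w, (M.δ v w).toReal * upperVal (S w) b ≤ upperVal (M.bellman S v) b := by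
  refine le_csInf (Set.insert_nonempty _ _) ?_
  rintro p (rfl | ⟨B, hB, hmem⟩)
  · exact (M.sum_le_sum_of_succ hc fun w _ => upperVal_le_one (hS w)).trans_eq (M.sum_const v 1)
  · obtain ⟨B', _, q, hq, h3⟩ := (M.mem_bellman_of_random S hc _).1 hmem
    obtain ⟨rfl, rfl⟩ := Prod.mk.inj h3
    exact M.sum_le_sum_of_succ hc fun w hw => upperVal_le (hS w) hB (hq w hw)

/-! ### Compactness of the value sets of the safety player -/

lemma isClosed_bellman (M : MDP V) {val : V → Set (ℝ × ℝ)} (hval : ∀ w, val w ⊆ unitSquare)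
    (hcl : ∀ w, IsClosed (val w)) (v : V) : IsClosed (M.bellman val v) := by
  classical
  by_cases hc : v ∈ M.control
  · have h1 : M.bellman val v = (fun y : ℝ × ℝ × ℝ => ((y.2.2 + y.2.1) / 2, y.1)) ''
        ((Set.Icc (0 : ℝ) 1 ×ˢ Set.Icc (0 : ℝ) 1 ×ˢ Set.Icc (0 : ℝ) 1) ∩
          ((⋃ w ∈ M.succ v, {y | (y.2.1, y.1) ∈ val w}) ∩
            ⋂ w ∈ M.succ v, {y | (y.2.2, y.1) ∈ val w})) := by
      ext x
      rw [M.mem_bellman_of_control val hc]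
      constructor
      · rintro ⟨p, hp, Bm, Bp, ⟨w, hw, h1⟩, h2, rfl⟩
        refine ⟨(p, Bm, Bp), ⟨⟨hp, (hval w h1).1, (hval w (h2 w hw)).1⟩, ?_, ?_⟩, rfl⟩
        · exact Set.mem_biUnion hw h1
        · exact Set.mem_biInter h2
      · rintro ⟨⟨p, Bm, Bp⟩, ⟨⟨hp, _⟩, h1, h2⟩, rfl⟩
        obtain ⟨w, hw, h1⟩ := Set.mem_iUnion₂.1 h1
        exact ⟨p, hp, Bm, Bp, ⟨w, hw, h1⟩, fun u hu => Set.mem_iInter₂.1 h2 u hu, rfl⟩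
    rw [h1]
    refine (IsCompact.image ?_ (by fun_prop)).isClosed
    refine (isCompact_Icc.prod (isCompact_Icc.prod isCompact_Icc)).inter_right (IsClosed.inter ?_ ?_)
    · exact (Set.toFinite _).isClosed_biUnion fun w _ => (hcl w).preimage (by fun_prop)
    · exact isClosed_biInter fun w _ => (hcl w).preimage (by fun_prop)
  · have h1 : M.bellman val v =
        (fun y : ℝ × (V → ℝ) => (y.1, ∑ w, (M.δ v w).toReal * y.2 w)) ''
        ((Set.Icc (0 : ℝ) 1 ×ˢ Set.Icc (0 : V → ℝ) 1) ∩
          ⋂ w ∈ M.succ v, {y | (y.1, y.2 w) ∈ val w}) := by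
      ext x
      rw [M.mem_bellman_of_random val hc]
      constructor
      · rintro ⟨B, hB, q, hq, rfl⟩
        -- Nothing constrains `q` off the successors; setting it to 0 there puts it in the compact
        -- cube without changing the sum.
        refine ⟨(B, fun w => if w ∈ M.succ v then q w else 0), ⟨⟨hB, ?_, ?_⟩, ?_⟩, ?_⟩
        · intro w
          by_cases hw : w ∈ M.succ v
          · simpa [hw] using (hval w (hq w hw)).2.1
          · simp [hw]
        · intro w
          by_cases hw : w ∈ M.succ v
          · simpa [hw] using (hval w (hq w hw)).2.2
          · simp [hw]
        · refine Set.mem_biInter fun w hw => ?_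
          change (B, if w ∈ M.succ v then q w else 0) ∈ val w
          rw [if_pos hw]
          exact hq w hw
        · refine Prod.ext rfl (Finset.sum_congr rfl fun w _ => ?_)
          by_cases hw : w ∈ M.succ v
          · simp [hw]
          · simp [M.toReal_eq_zero_of_notMem_succ hc hw]
      · rintro ⟨⟨B, q⟩, ⟨⟨hB, _⟩, hq⟩, rfl⟩
        exact ⟨B, hB, q, fun u hu => Set.mem_iInter₂.1 hq u hu, rfl⟩
    rw [h1]
    refine (IsCompact.image ?_ (by fun_prop)).isClosed
    exact (isCompact_Icc.prod isCompact_Icc).inter_right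
      (isClosed_biInter fun w _ => (hcl w).preimage (by fun_prop))

lemma isClosed_sVal (M : MDP V) (T : Set V) : ∀ i v, IsClosed (M.sVal T i v)
  | 0, v => by
    simp only [sVal]
    split_ifs
    · exact (isClosed_Icc.prod isClosed_singleton).union (isClosed_singleton.prod isClosed_Icc)
    · exact isClosed_Icc.prod isClosed_Icc
  | i + 1, v => M.isClosed_bellman (M.sVal_subset_unitSquare T i) (M.isClosed_sVal T i) v

/-- At a sink the operator only takes midpoints of two points of the same set with equal p, or
leaves points fixed. The horizontal slices of the initial set at a target are convex, so nothing new
arises. Off T the initial set is the whole square. -/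
lemma sVal_one_subset (M : MDP V) (T : Set V) (hT : ∀ t ∈ T, M.IsSink t) (v : V) :
    M.sVal T 1 v ⊆ M.sVal T 0 v := by
  by_cases hv : v ∈ T
  · have hs : M.succ v = {v} := hT v hv
    intro x hx
    have hx' := M.sVal_subset_unitSquare T 1 v hx
    have key : ∀ B p, (B, p) ∈ M.sVal T 0 v ↔
        (B ∈ Set.Icc (0 : ℝ) 1 ∧ p = 1) ∨ (B = 0 ∧ p ∈ Set.Icc (0 : ℝ) 1) := by
      intro B p
      simp [sVal, hv]
    change x ∈ M.bellman (M.sVal T 0) v at hx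
    by_cases hc : v ∈ M.control
    · obtain ⟨p, hp, Bm, Bp, ⟨w, hw, h1⟩, h2, rfl⟩ := (M.mem_bellman_of_control _ hc x).1 hx
      rw [hs, Set.mem_singleton_iff] at hw
      subst hw
      have h2 := h2 w (by simp [hs])
      rw [key] at h1 h2 ⊢
      rcases h1 with h1 | h1
      · exact Or.inl ⟨hx'.1, h1.2⟩
      · rcases h2 with h2 | h2
        · exact Or.inl ⟨hx'.1, h2.2⟩
        · exact Or.inr ⟨by rw [h1.1, h2.1]; norm_num, hp⟩
    · obtain ⟨B, hB, q, hq, rfl⟩ := (M.mem_bellman_of_random _ hc x).1 hx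
      have hsum : ∑ w, (M.δ v w).toReal * q w = q v := by
        rw [← M.sum_const v (q v)]
        have : ∀ w ∈ M.succ v, q w = q v := by
          intro w hw
          rw [hs, Set.mem_singleton_iff] at hw
          rw [hw]
        exact le_antisymm (M.sum_le_sum_of_succ hc fun w hw => (this w hw).le)
          (M.sum_le_sum_of_succ hc fun w hw => (this w hw).ge)
      rw [hsum]
      exact hq v (by simp [hs])
  · have : M.sVal T 0 v = unitSquare := by simp [sVal, hv, unitSquare]
    rw [this]
    exact M.sVal_subset_unitSquare T 1 v

lemma sVal_antitone (M : MDP V) (T : Set V) (hT : ∀ t ∈ T, M.IsSink t) (v : V) :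
    Antitone fun i => M.sVal T i v := by
  have : ∀ i v, M.sVal T (i + 1) v ⊆ M.sVal T i v := by
    intro i
    induction i with
    | zero => exact M.sVal_one_subset T hT
    | succ i ih => exact fun v => M.bellman_mono ih v
  exact antitone_nat_of_succ_le fun i => this i v

/-- The Bellman operator is continuous from above on closed value sets. -/
lemma iInter_bellman_subset (M : MDP V) {S : ℕ → V → Set (ℝ × ℝ)}
    (hS : ∀ i w, S i w ⊆ unitSquare) (hcl : ∀ i w, IsClosed (S i w))
    (hanti : ∀ w, Antitone fun i => S i w) (v : V) :
    ⋂ i, M.bellman (S i) v ⊆ M.bellman (fun w => ⋂ i, S i w) v := by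
  classical
  rintro ⟨b, p⟩ hx
  rw [Set.mem_iInter] at hx
  by_cases hc : v ∈ M.control
  -- `K i` collects the pairs (B₋, B₊) witnessing membership at stage i; nested nonempty compact
  -- sets have a common point.
  · let K : ℕ → Set (ℝ × ℝ) := fun i => (⋃ w ∈ M.succ v, {y | (y.1, p) ∈ S i w}) ∩
      ((⋂ w ∈ M.succ v, {y | (y.2, p) ∈ S i w}) ∩ {y | (y.2 + y.1) / 2 = b})
    have hKcl : ∀ i, IsClosed (K i) := fun i => by
      refine IsClosed.inter ?_ (IsClosed.inter ?_ ?_)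
      · exact (Set.toFinite _).isClosed_biUnion fun w _ => (hcl i w).preimage (by fun_prop)
      · exact isClosed_biInter fun w _ => (hcl i w).preimage (by fun_prop)
      · exact isClosed_eq (by fun_prop) (by fun_prop)
    have hKanti : ∀ i, K (i + 1) ⊆ K i := fun i =>
      Set.inter_subset_inter
        (Set.iUnion₂_mono fun w _ y hy => hanti w i.le_succ hy)
        (Set.inter_subset_inter_left _
          (Set.iInter₂_mono fun w _ y hy => hanti w i.le_succ hy))
    have hKne : ∀ i, (K i).Nonempty := fun i => by
      obtain ⟨p', hp', Bm, Bp, ⟨w, hw, h1⟩, h2, h3⟩ := (M.mem_bellman_of_control _ hc _).1 (hx i)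
      obtain ⟨rfl, rfl⟩ := Prod.mk.inj h3
      exact ⟨(Bm, Bp), Set.mem_biUnion hw h1, Set.mem_biInter h2, rfl⟩
    have hK0 : IsCompact (K 0) := by
      refine (isCompact_Icc.prod isCompact_Icc : IsCompact unitSquare).of_isClosed_subset
        (hKcl 0) ?_
      rintro ⟨Bm, Bp⟩ ⟨h1, h2, _⟩
      obtain ⟨w, hw, h1⟩ := Set.mem_iUnion₂.1 h1
      exact ⟨(hS 0 w h1).1, (hS 0 w (Set.mem_iInter₂.1 h2 w hw)).1⟩
    obtain ⟨⟨Bm, Bp⟩, hy⟩ :=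
      IsCompact.nonempty_iInter_of_sequence_nonempty_isCompact_isClosed K hKanti hKne hK0 hKcl
    rw [Set.mem_iInter] at hy
    -- The successor could vary with i. If each successor w failed at some stage `j w`, all would
    -- fail at the largest of these finitely many stages, by antitonicity.
    have hw : ∃ w ∈ M.succ v, ∀ i, (Bm, p) ∈ S i w := by
      by_contra! hcon
      choose! j hj using hcon
      obtain ⟨w, hw, h1⟩ := Set.mem_iUnion₂.1 (hy (Finset.univ.sup j)).1
      exact hj w hw (hanti w (Finset.le_sup (Finset.mem_univ w)) h1)
    obtain ⟨w, hw, h1⟩ := hw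
    refine (M.mem_bellman_of_control _ hc _).2 ⟨p, (hS 0 w (h1 0)).2, Bm, Bp,
      ⟨w, hw, Set.mem_iInter.2 h1⟩,
      fun u hu => Set.mem_iInter.2 fun i => Set.mem_iInter₂.1 (hy i).2.1 u hu, ?_⟩
    exact Prod.ext (hy 0).2.2.symm rfl
  · let K : ℕ → Set (V → ℝ) := fun i => Set.Icc (0 : V → ℝ) 1 ∩
      ((⋂ w ∈ M.succ v, {q | (b, q w) ∈ S i w}) ∩ {q | ∑ w, (M.δ v w).toReal * q w = p})
    have hKcl : ∀ i, IsClosed (K i) := fun i => by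
      refine IsClosed.inter isClosed_Icc (IsClosed.inter ?_ ?_)
      · exact isClosed_biInter fun w _ => (hcl i w).preimage (by fun_prop)
      · exact isClosed_eq (by fun_prop) (by fun_prop)
    have hKanti : ∀ i, K (i + 1) ⊆ K i := fun i =>
      Set.inter_subset_inter_right _ (Set.inter_subset_inter_left _
          (Set.iInter₂_mono fun w _ y hy => hanti w i.le_succ hy))
    have hb : b ∈ Set.Icc (0 : ℝ) 1 := (M.bellman_subset_unitSquare (hS 0) v (hx 0)).1
    have hKne : ∀ i, (K i).Nonempty := fun i => by
      obtain ⟨B', hB', q, hq, h3⟩ := (M.mem_bellman_of_random _ hc _).1 (hx i)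
      obtain ⟨rfl, rfl⟩ := Prod.mk.inj h3
      refine ⟨fun w => if w ∈ M.succ v then q w else 0, ⟨fun w => ?_, fun w => ?_⟩, ?_, ?_⟩
      · by_cases hw : w ∈ M.succ v
        · simpa [hw] using (hS i w (hq w hw)).2.1
        · simp [hw]
      · by_cases hw : w ∈ M.succ v
        · simpa [hw] using (hS i w (hq w hw)).2.2
        · simp [hw]
      · refine Set.mem_biInter fun w hw => ?_
        change (b, if w ∈ M.succ v then q w else 0) ∈ S i w
        rw [if_pos hw]
        exact hq w hw
      · refine Finset.sum_congr rfl fun w _ => ?_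
        by_cases hw : w ∈ M.succ v
        · simp [hw]
        · simp [M.toReal_eq_zero_of_notMem_succ hc hw]
    have hK0 : IsCompact (K 0) :=
      isCompact_Icc.of_isClosed_subset (hKcl 0) Set.inter_subset_left
    obtain ⟨q, hq⟩ :=
      IsCompact.nonempty_iInter_of_sequence_nonempty_isCompact_isClosed K hKanti hKne hK0 hKcl
    rw [Set.mem_iInter] at hq
    exact (M.mem_bellman_of_random _ hc _).2 ⟨b, hb, q,
      fun w hw => Set.mem_iInter.2 fun i => Set.mem_iInter₂.1 (hq i).2.1 w hw,
      Prod.ext rfl (hq 0).2.2.symm⟩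

/-- Every promise of the limit set is renewed by one round within the same set, which is what
unbounded play requires. -/
lemma sValStar_subset_bellman (M : MDP V) (T : Set V) (hT : ∀ t ∈ T, M.IsSink t) (v : V) :
    M.sValStar T v ⊆ M.bellman (M.sValStar T) v := by
  have h := M.iInter_bellman_subset (M.sVal_subset_unitSquare T) (M.isClosed_sVal T)
    (M.sVal_antitone T hT) v
  exact fun x hx => h (Set.mem_iInter.2 fun i => Set.mem_iInter.1 hx (i + 1))

lemma sValStar_subset_unitSquare (M : MDP V) (T : Set V) (v : V) :
    M.sValStar T v ⊆ unitSquare :=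
  (Set.iInter_subset _ 0).trans (M.sVal_subset_unitSquare T 0 v)

end MDP

/-! ### Policies for the whole game -/

namespace MDP

variable {V : Type*} [Fintype V]

/-- One step of the game in which the reachability player bids so as to secure `lowerVal`. -/
lemma le_stepExp_lowerVal (M : MDP V) (σ τ : M.Policy) {B : ℝ} (hB : B ∈ Set.Icc (0 : ℝ) 1)
    {n : ℕ} (h : History V n) {R : V → Set (ℝ × ℝ)} (hR : ∀ w, R w ⊆ unitSquare) {ε : ℝ}
    (hε : 0 < ε)
    (hσ : h.last ∈ M.control → ∀ b ∈ Set.Icc (0 : ℝ) 1,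
      lowerVal (M.bellman R h.last) b - ε ≤ lowerVal (R (σ.move b n h)) (b - σ.bid b n h) ∧
        ∀ y, σ.bid b n h < y → ∀ u ∈ M.succ h.last,
          lowerVal (M.bellman R h.last) b - ε ≤ lowerVal (R u) (b + y)) :
    lowerVal (M.bellman R h.last) (M.budget σ τ B n h) - ε ≤
      M.stepExp (M.inducedScheduler σ τ B) h
        fun w => lowerVal (R w) (M.budget σ τ B (n + 1) (h.snoc w)) := by
  by_cases hc : h.last ∈ M.control
  · obtain ⟨h1, h2⟩ := hσ hc _ (M.budget_mem σ τ hB n h)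
    rw [M.stepExp_of_control _ _ _ hc]
    by_cases hb : τ.bid (1 - M.budget σ τ B n h) n h ≤ σ.bid (M.budget σ τ B n h) n h
    · rw [M.budget_snoc_of_le σ τ B h _ hc hb]
      simpa [inducedScheduler, hb] using h1
    · rw [M.budget_snoc_of_lt σ τ B h _ hc (not_le.1 hb)]
      simpa [inducedScheduler, hb] using h2 _ (not_le.1 hb) _ (τ.move_mem _ n h hc)
  · rw [M.stepExp_of_random _ _ _ hc]
    simp only [M.budget_snoc_of_random σ τ B h _ hc]
    linarith [M.lowerVal_bellman_le_of_random hR hc (M.budget σ τ B n h)]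

/-- One step of the game in which the safety player bids so as to secure `upperVal`. -/
lemma stepExp_upperVal_le (M : MDP V) (σ τ : M.Policy) {B : ℝ} (hB : B ∈ Set.Icc (0 : ℝ) 1)
    {n : ℕ} (h : History V n) {S : V → Set (ℝ × ℝ)} (hS : ∀ w, S w ⊆ unitSquare) {ε : ℝ}
    (hε : 0 < ε)
    (hτ : h.last ∈ M.control → ∀ c ∈ Set.Icc (0 : ℝ) 1,
      upperVal (S (τ.move c n h)) (1 - c + τ.bid c n h) ≤
          upperVal (M.bellman S h.last) (1 - c) + ε ∧
        ∀ y, τ.bid c n h ≤ y → ∀ u ∈ M.succ h.last,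
          upperVal (S u) (1 - c - y) ≤ upperVal (M.bellman S h.last) (1 - c) + ε) :
    (M.stepExp (M.inducedScheduler σ τ B) h
        fun w => upperVal (S w) (M.budget σ τ B (n + 1) (h.snoc w))) ≤
      upperVal (M.bellman S h.last) (M.budget σ τ B n h) + ε := by
  by_cases hc : h.last ∈ M.control
  · have hb := M.budget_mem σ τ hB n h
    obtain ⟨h1, h2⟩ := hτ hc (1 - M.budget σ τ B n h) ⟨by linarith [hb.2], by linarith [hb.1]⟩
    -- The bid was chosen from the safety player's budget c = 1 - b; this returns to b.
    rw [sub_sub_cancel] at h1 h2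
    rw [M.stepExp_of_control _ _ _ hc]
    by_cases hb : τ.bid (1 - M.budget σ τ B n h) n h ≤ σ.bid (M.budget σ τ B n h) n h
    · rw [M.budget_snoc_of_le σ τ B h _ hc hb]
      simpa [inducedScheduler, hb] using h2 _ hb _ (σ.move_mem _ n h hc)
    · rw [M.budget_snoc_of_lt σ τ B h _ hc (not_le.1 hb)]
      simpa [inducedScheduler, hb] using h1
  · rw [M.stepExp_of_random _ _ _ hc]
    simp only [M.budget_snoc_of_random σ τ B h _ hc]
    linarith [M.le_upperVal_bellman_of_random hS hc (M.budget σ τ B n h)]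

lemma exists_mem_of_mem_interior {A : Set (ℝ × ℝ)} {B p : ℝ} (h : (B, p) ∈ interior A) :
    ∃ η > 0, (B - η, p + η) ∈ A ∧ (B + η, p - η) ∈ A := by
  obtain ⟨ε, hε, hball⟩ := Metric.mem_nhds_iff.1 (mem_interior_iff_mem_nhds.1 h)
  refine ⟨ε / 2, half_pos hε, hball ?_, hball ?_⟩ <;>
  · rw [Metric.mem_ball, Prod.dist_eq]
    simp [abs_of_pos hε, hε]

/-- Promises count only at budgets B < b ≤ 1, which excludes the segment {1}×[0,1]. -/
lemma lowerVal_rVal_zero_le (M : MDP V) (T : Set V) {v : V} (hv : v ∉ T) {b : ℝ} (hb : b ≤ 1) :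
    lowerVal (M.rVal T 0 v) b ≤ 0 := by
  refine csSup_le (Set.insert_nonempty _ _) ?_
  rintro p (rfl | ⟨B, hB, hmem⟩)
  · exact le_rfl
  · simp only [rVal, hv, if_false] at hmem
    rcases hmem with hmem | hmem
    · exact (hmem.2 : p = 0).le
    · have : B = 1 := hmem.1
      linarith

/-- Promises count only at budgets B > b ≥ 0, which excludes {0}×[0,1] in the stage 0 set. -/
lemma one_le_upperVal_sValStar (M : MDP V) (T : Set V) {v : V} (hv : v ∈ T) {b : ℝ}
    (hb : 0 ≤ b) : 1 ≤ upperVal (M.sValStar T v) b := by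
  refine le_csInf (Set.insert_nonempty _ _) ?_
  rintro p (rfl | ⟨B, hB, hmem⟩)
  · exact le_rfl
  · have hmem := Set.mem_iInter.1 hmem 0
    simp only [sVal, hv, if_true] at hmem
    rcases hmem with hmem | hmem
    · exact (hmem.2 : p = 1).ge
    · have : B = 0 := hmem.1
      linarith

lemma upperVal_anti {S S' : Set (ℝ × ℝ)} (hS' : S' ⊆ unitSquare) (h : S ⊆ S') (b : ℝ) :
    upperVal S' b ≤ upperVal S b :=
  csInf_le_csInf (bddBelow_upperVal hS') (Set.insert_nonempty _ _)
    (Set.insert_subset_insert fun _ ⟨B, hB, hmem⟩ => ⟨B, hB, h hmem⟩)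

variable [MeasurableSpace V] [DiscreteMeasurableSpace V]

/-- The reachability player secures the finite horizon value up to an arbitrary error. -/
lemma exists_reach_policy (M : MDP V) (T : Set V) (v : V) {B : ℝ} (hB : B ∈ Set.Icc (0 : ℝ) 1)
    (N : ℕ) {ε : ℝ} (hε : 0 < ε) :
    ∃ σ : M.Policy, ∀ τ : M.Policy,
      lowerVal (M.rVal T N v) B - N * ε ≤ M.prob σ τ v B (reach T) := by
  classical
  obtain ⟨σ, hσ⟩ := M.exists_policy _ fun n h b hc hb =>
    M.exists_reach_bid (M.rVal_subset_unitSquare T (N - (n + 1))) hc hb hε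
  refine ⟨σ, fun τ => ?_⟩
  -- The value for the remaining horizon N - n, frozen at 1 once T is visited, minus one ε for each
  -- remaining round.
  let W : ∀ n, History V n → ℝ := fun n h =>
    (if h.Visits T then 1 else lowerVal (M.rVal T (N - n) h.last) (M.budget σ τ B n h)) -
      ((N - n : ℕ) : ℝ) * ε
  have hW := M.le_pathMeasure_reach (M.inducedScheduler σ τ B) v T N W ?_ ?_
  · refine le_trans ?_ hW
    simp only [W, Nat.sub_zero]
    refine sub_le_sub_right ?_ _
    split_ifs
    · exact lowerVal_le_one (M.rVal_subset_unitSquare T N v)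
    · exact le_rfl
  · intro n hn h
    obtain ⟨k, rfl⟩ := Nat.exists_eq_add_of_lt hn
    have e1 : n + k + 1 - n = k + 1 := by omega
    have e2 : n + k + 1 - (n + 1) = k := by omega
    simp only [W, e1, e2, sub_eq_add_neg (_ : ℝ) ((k : ℝ) * ε)]
    rw [M.stepExp_add_const]
    push_cast
    by_cases hv : h.Visits T
    · simp only [hv, History.visits_snoc, true_or, if_true]
      rw [M.stepExp_const]
      linarith
    · have h1 := M.le_stepExp_lowerVal σ τ hB h (M.rVal_subset_unitSquare T k) hε
        fun hc b hb => by simpa only [e2] using hσ n h b hc hb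
      have h2 : (M.stepExp (M.inducedScheduler σ τ B) h
          fun w => lowerVal (M.rVal T k w) (M.budget σ τ B (n + 1) (h.snoc w))) ≤
          M.stepExp (M.inducedScheduler σ τ B) h fun w => if (h.snoc w).Visits T then 1 else
            lowerVal (M.rVal T k (h.snoc w).last) (M.budget σ τ B (n + 1) (h.snoc w)) := by
        refine M.stepExp_mono _ _ fun w => ?_
        split_ifs
        · exact lowerVal_le_one (M.rVal_subset_unitSquare T k w)
        · rw [History.last_snoc]
      rw [if_neg hv]
      change lowerVal (M.rVal T (k + 1) h.last) _ - ε ≤ _ at h1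
      linarith
  · intro h
    simp only [W, Nat.sub_self, Nat.cast_zero, zero_mul, sub_zero, visitInd]
    split_ifs with hv
    · exact le_rfl
    · exact M.lowerVal_rVal_zero_le T (fun hl => hv ⟨_, hl⟩) (M.budget_mem σ τ hB N h).2

/-- The safety player secures the limit value up to an arbitrary error. -/
lemma exists_safe_policy (M : MDP V) (T : Set V) (hT : ∀ t ∈ T, M.IsSink t) (v : V) {B : ℝ}
    (hB : B ∈ Set.Icc (0 : ℝ) 1) {ε : ℝ} (hε : 0 < ε) :
    ∃ τ : M.Policy, ∀ σ : M.Policy,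
      M.prob σ τ v B (reach T) ≤ upperVal (M.sValStar T v) B + ε := by
  classical
  have hS := M.sValStar_subset_unitSquare T
  have hpos : ∀ n : ℕ, 0 < ε / 2 ^ (n + 1) := fun n => by positivity
  obtain ⟨τ, hτ⟩ := M.exists_policy _ fun n h c hc hb => M.exists_safe_bid hS hc hb (hpos n)
  refine ⟨τ, fun σ => ?_⟩
  -- Before round n the reserve is ε/2ⁿ; the round spends half of it and keeps the other half.
  -- Freezing at 1 on entering T cannot raise `W`, as `upperVal` is at least 1 there.
  let W : ∀ n, History V n → ℝ := fun n h =>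
    (if h.Visits T then 1 else upperVal (M.sValStar T h.last) (M.budget σ τ B n h)) + ε / 2 ^ n
  have hW := M.pathMeasure_reach_le (M.inducedScheduler σ τ B) v T W ?_ ?_
  · refine le_trans hW ?_
    simp only [W, pow_zero, div_one]
    refine add_le_add_left ?_ _
    split_ifs with hv
    · obtain ⟨_, hv⟩ := hv
      exact M.one_le_upperVal_sValStar T hv hB.1
    · exact le_rfl
  · intro n h
    simp only [W]
    rw [M.stepExp_add_const]
    have e : ε / 2 ^ n = ε / 2 ^ (n + 1) + ε / 2 ^ (n + 1) := by
      rw [pow_succ]; field_simp; norm_num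
    by_cases hv : h.Visits T
    · simp only [hv, History.visits_snoc, true_or, if_true]
      rw [M.stepExp_const]
      linarith [hpos n]
    · have h1 := M.stepExp_upperVal_le σ τ hB h hS (hpos n) fun hc b hb => hτ n h b hc hb
      have h2 : (M.stepExp (M.inducedScheduler σ τ B) h fun w =>
            if (h.snoc w).Visits T then 1 else
              upperVal (M.sValStar T (h.snoc w).last) (M.budget σ τ B (n + 1) (h.snoc w))) ≤
          M.stepExp (M.inducedScheduler σ τ B) h
            fun w => upperVal (M.sValStar T w) (M.budget σ τ B (n + 1) (h.snoc w)) := by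
        refine M.stepExp_mono _ _ fun w => ?_
        rw [History.last_snoc]
        split_ifs with hw
        · exact M.one_le_upperVal_sValStar T
            (((h.visits_snoc w T).1 hw).resolve_left hv) (M.budget_mem σ τ hB _ _).1
        · exact le_rfl
      have h3 := upperVal_anti (M.bellman_subset_unitSquare hS h.last)
        (M.sValStar_subset_bellman T hT h.last) (M.budget σ τ B n h)
      rw [if_neg hv]
      linarith
  · intro n h
    simp only [W, visitInd]
    have : 0 < ε / 2 ^ n := by positivity
    split_ifs
    · linarith
    · linarith [upperVal_nonneg (b := M.budget σ τ B n h) (hS h.last)]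

end MDP

/-! ### From interior points to exact guarantees -/

theorem mainTheorem2 {V : Type*} [Fintype V] [MeasurableSpace V] [DiscreteMeasurableSpace V]
    (M : MDP V) (T : Set V) (hT : ∀ t ∈ T, M.IsSink t) (v : V) (B p : ℝ) :
    ((B, p) ∈ interior (M.rValStar T v) → (M.winReach B p v (MDP.reach T)).Nonempty) ∧
    ((B, p) ∈ interior (M.sValStar T v) → (M.winSafe B p v (MDP.reach T)).Nonempty) := by
  constructor
  · intro h
    have hB : B ∈ Set.Icc (0 : ℝ) 1 := by
      have hsub : M.rValStar T v ⊆ MDP.unitSquare :=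
        closure_minimal (Set.iUnion_subset fun i => M.rVal_subset_unitSquare T i v)
          (isClosed_Icc.prod isClosed_Icc)
      exact (hsub (interior_subset h)).1
    obtain ⟨η, hη, hmem, _⟩ := MDP.exists_mem_of_mem_interior h
    -- A finite-horizon point within η of (B - η, p + η) still has B' < B and p' > p; the gap p' - p
    -- pays for the N errors.
    obtain ⟨⟨B', p'⟩, hU, hdist⟩ := Metric.mem_closure_iff.1 hmem η hη
    obtain ⟨N, hN⟩ := Set.mem_iUnion.1 hU
    rw [Prod.dist_eq, max_lt_iff, Real.dist_eq, Real.dist_eq, abs_lt, abs_lt] at hdist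
    obtain ⟨⟨h1, _⟩, _, h2⟩ := hdist
    dsimp only at h1 h2
    have hp : p < p' := by linarith
    obtain ⟨σ, hσ⟩ := M.exists_reach_policy T v hB N (ε := (p' - p) / (N + 1))
      (div_pos (sub_pos.2 hp) (by positivity))
    refine ⟨σ, fun τ => le_trans ?_ (hσ τ)⟩
    have h3 := MDP.le_lowerVal (M.rVal_subset_unitSquare T N v) (by linarith : B' < B) hN
    have h4 : (N : ℝ) * ((p' - p) / (N + 1)) ≤ p' - p := by
      rw [← mul_div_assoc, div_le_iff₀ (by positivity)]
      nlinarith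
    linarith
  · intro h
    have hS := M.sValStar_subset_unitSquare T v
    obtain ⟨η, hη, _, hmem⟩ := MDP.exists_mem_of_mem_interior h
    -- The promise p - η at budget B + η leaves exactly η for the total error.
    obtain ⟨τ, hτ⟩ := M.exists_safe_policy T hT v (hS (interior_subset h)).1 hη
    refine ⟨τ, fun σ => (hτ σ).trans ?_⟩
    linarith [MDP.upperVal_le hS (by linarith : B < B + η) hmem]
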